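/- The algorithm $\mathrm{FaceIterator}$ takes as input a finite list $C$ ("coatoms") and a finite list $S$ ("ignored sets") of subsets of $\{1,\dots,n\}$, and a set $A \subseteq \{1,\dots,n\}$ ("ignored atoms"). If $C$ is empty, it stops without output. Otherwise, let $a$ be the first element of $C$. 1. If $a \cap A = \emptyset$, output $a$. 2. Let $N = \{a \cap b : b \in C,\ b \neq a\}$, remove from $N$ every set contained in a member of $S$, and then keep only the inclusion-maximal sets (each once). Call $\mathrm{FaceIterator}(N, S, A)$, where $N$ is listed in any order. 3. Let $C' = \{x \in C : x \not\subseteq a \cup A\}$, and append $a \cup A$ to $S$ to obtain $S'$. Call $\mathrm{FaceIterator}(C', S', A)$, where $C'$ is listed in any order. (The orders in steps 2 and 3 are given by a fixed but arbitrary rule that rearranges lists.) Corollary 3.4. Let $P \subset \mathbb{R}^d$ be a polytope (the convex hull of a finite set) with vertices $v_1,\dots,v_n$ and facets $F_1,\dots,F_m$, each listed once, in any order. The faces of $P$ are $\emptyset$ and the sets of maximizers over $P$ of linear functionals (so $P$ is a face of itself), the vertices are the points $x$ such that $\{x\}$ is a face, and the facets are the faces of dimension $\dim P - 1$, where $\dim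 \emptyset = -1$. Let the vertex-facet incidences of $P$ be given, that is, the $n \times m$ matrix recording whether $v_i \in F_j$, and let $C_j = \{i : v_i \in F_j\}$. Identify a face $F$ of $P$ with its vertex set $\{i : v_i \in F\}$. Then $\mathrm{FaceIterator}([C_1,\dots,C_m], [\,], \emptyset)$ visits every face $F \neq P$ of $P$ (including $\emptyset$) exactly once and visits nothing else. That is, $F \mapsto \{i : v_i \in F\}$ is a bijection from the set of these faces onto the set of all outputs, and no set is output twice. Consequently, if the upper bound $\{1,\dots,n\}$ is visited as well, before the call, then every face of $P$, including $P$ itself, is visited exactly once and nothing else is visited. -/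

import Mathlib

namespace FaceIteration

section Algorithm

variable {α : Type*} [DecidableEq α]

/-- The inclusion-maximal members of a list of finite sets, each listed once. -/
def inclusionMaximals (l : List (Finset α)) : List (Finset α) :=
  l.dedup.filter (fun x => ∀ y ∈ l, x ⊆ y → x = y)

/-- The sets `a ∩ b` for `b ∈ coatoms ∖ {a}` that are contained in no member of `ignoredSets`,
reduced to the inclusion-maximal ones. -/
def newCoatoms (a : Finset α) (coatoms ignoredSets : List (Finset α)) : List (Finset α) :=
  inclusionMaximals
    (((coatoms.filter (fun b => b ≠ a)).map (fun b => a ∩ b)).filter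
      (fun x => ∀ y ∈ ignoredSets, ¬ x ⊆ y))

/-- The members of `coatoms` that are not contained in `a ∪ ignoredAtoms`. -/
def nextCoatoms (a : Finset α) (coatoms : List (Finset α)) (ignoredAtoms : Finset α) :
    List (Finset α) :=
  coatoms.filter (fun x => ¬ x ⊆ a ∪ ignoredAtoms)

theorem length_newCoatoms_lt (a : Finset α) (rest ignoredSets : List (Finset α)) :
    (newCoatoms a (a :: rest) ignoredSets).length < (a :: rest).length := by
  unfold newCoatoms inclusionMaximals
  refine lt_of_le_of_lt (List.length_filter_le _ _) ?_
  refine lt_of_le_of_lt (List.dedup_sublist _).length_le ?_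
  refine lt_of_le_of_lt (List.length_filter_le _ _) ?_
  rw [List.length_map, List.length_cons]
  have h : (a :: rest).filter (fun b => b ≠ a) = rest.filter (fun b => b ≠ a) := by simp
  rw [h]
  exact Nat.lt_succ_of_le (List.length_filter_le _ _)

theorem length_nextCoatoms_lt (a : Finset α) (rest : List (Finset α)) (ignoredAtoms : Finset α) :
    (nextCoatoms a (a :: rest) ignoredAtoms).length < (a :: rest).length := by
  unfold nextCoatoms
  have h : (a :: rest).filter (fun x => ¬ x ⊆ a ∪ ignoredAtoms)
      = rest.filter (fun x => ¬ x ⊆ a ∪ ignoredAtoms) := by simp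
  rw [h, List.length_cons]
  exact Nat.lt_succ_of_le (List.length_filter_le _ _)

/-- The algorithm `FaceIterator`. The value is the list of all sets that the iterator outputs, in
the order of their output. The function `arrange` is the order in which the two newly computed
collections of sets are stored as lists; it may be any rearrangement. -/
def faceIterator (arrange : List (Finset α) → List (Finset α))
    (harrange : ∀ l, (arrange l).Perm l) :
    (coatoms ignoredSets : List (Finset α)) → (ignoredAtoms : Finset α) → List (Finset α)
  | [], _, _ => []
  | a :: rest, ignoredSets, ignoredAtoms =>
      (if a ∩ ignoredAtoms = ∅ then [a] else []) ++
      faceIterator arrange harrange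
        (arrange (newCoatoms a (a :: rest) ignoredSets))
        ignoredSets ignoredAtoms ++
      faceIterator arrange harrange
        (arrange (nextCoatoms a (a :: rest) ignoredAtoms))
        (ignoredSets ++ [a ∪ ignoredAtoms]) ignoredAtoms
termination_by coatoms _ _ => coatoms.length
decreasing_by
  · rw [(harrange _).length_eq]; exact length_newCoatoms_lt a rest ignoredSets
  · rw [(harrange _).length_eq]; exact length_nextCoatoms_lt a rest ignoredAtoms

/-- The coatoms read off from a vertex-facet incidence matrix: for each facet, the set of the
(indices of the) vertices on it. -/
def coatomsOfIncidences {n m : ℕ} (I : Matrix (Fin n) (Fin m) Bool) : List (Finset (Fin n)) :=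
  List.ofFn (fun j : Fin m => Finset.univ.filter (fun i => I i j = true))

end Algorithm

section Polytopes

variable {E : Type*} [NormedAddCommGroup E] [NormedSpace ℝ E]

/-- A polytope is the convex hull of finitely many points. -/
def IsPolytope (P : Set E) : Prop :=
  ∃ S : Set E, S.Finite ∧ P = convexHull ℝ S

/-- The faces of a polytope are `∅` and the sets of maximizers of linear functionals over `P`
(so `P` itself is a face, by the functional `0`). -/
def IsFace (P F : Set E) : Prop :=
  IsExposed ℝ P F

open Classical in
/-- The dimension of the affine hull, with the convention that the empty set has dimension `-1`. -/
noncomputable def dim (F : Set E) : ℤ :=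
  if F.Nonempty then (Module.finrank ℝ (vectorSpan ℝ F) : ℤ) else -1

/-- The vertices: the points `x` such that `{x}` is a face. -/
def vertices (P : Set E) : Set E :=
  {x | IsFace P {x}}

/-- The facets: the faces of dimension `dim P - 1`. -/
def facets (P : Set E) : Set (Set E) :=
  {F | IsFace P F ∧ dim F = dim P - 1}

open Classical in
/-- The (indices of the) vertices on `F`, where `v` is an enumeration of the vertices. -/
noncomputable def vertexSet {n : ℕ} (v : Fin n → E) (F : Set E) : Finset (Fin n) :=
  Finset.univ.filter (fun i => v i ∈ F)

/-- The list `out` of vertex sets visits every member of the family `𝓕` exactly once, and visits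
nothing else. -/
def VisitsExactlyOnce {n : ℕ} (v : Fin n → E) (out : List (Finset (Fin n)))
    (𝓕 : Set (Set E)) : Prop :=
  out.Nodup ∧ Set.BijOn (vertexSet v) 𝓕 {s | s ∈ out}

end Polytopes

end FaceIteration

/-! A face is the hull of its vertices, so faces correspond to the zero sets, on the vertices, of
nonpositive affine functions (`image_vertexSet_faces`, `injOn_vertexSet`). This family is closed
under intersection and satisfies a weak diamond property (`hasBypass_zeroSets`), and the facets are
its maximal proper members.

These two properties are all the algorithm needs. If the coatoms are the non-ignored maximal members
below `G`, the output is every non-ignored member strictly below `G`, once (`faceIterator_spec`).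
Such a member equals `a`, lies strictly below `a`, or is not contained in `a`; the two recursive
calls handle the last two cases. -/

namespace FaceIteration

/-! ### Correctness for abstract families of finite sets -/

section Combinatorics

variable {α : Type*}

/-- The members of `𝓛` that are maximal among those strictly below `G`. -/
def IsMaximalBelow (𝓛 : Set (Finset α)) (G x : Finset α) : Prop :=
  Maximal (fun y => y ∈ 𝓛 ∧ y ⊂ G) x

theorem IsMaximalBelow.eq_of_subset {𝓛 : Set (Finset α)} {G x y : Finset α}
    (hx : IsMaximalBelow 𝓛 G x) (hy : y ∈ 𝓛) (hyG : y ⊂ G) (hxy : x ⊆ y) : x = y :=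
  Maximal.eq_of_le hx ⟨hy, hyG⟩ hxy

theorem exists_isMaximalBelow_ge {𝓛 : Set (Finset α)} {G x : Finset α} (hx : x ∈ 𝓛)
    (hxG : x ⊂ G) : ∃ y, x ⊆ y ∧ IsMaximalBelow 𝓛 G y := by
  have hfin : {y | y ∈ 𝓛 ∧ y ⊂ G}.Finite :=
    G.powerset.finite_toSet.subset fun y hy => by simpa using hy.2.subset
  exact hfin.exists_le_maximal (a := x) ⟨hx, hxG⟩

/-- Every chain `c ⊂ a ⊂ G` of members of `𝓛` can be bypassed on a member above `c` and
strictly below `G` that is not below `a`. -/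
def HasBypass (𝓛 : Set (Finset α)) : Prop :=
  ∀ ⦃c a G⦄, c ∈ 𝓛 → a ∈ 𝓛 → G ∈ 𝓛 → c ⊂ a → a ⊂ G → ∃ b ∈ 𝓛, c ⊆ b ∧ b ⊂ G ∧ ¬ b ⊆ a

/-- `coatoms` lists the maximal members of `𝓛` strictly below `G` that are in no ignored set. -/
def ListsCoatoms (𝓛 : Set (Finset α)) (G : Finset α) (S coatoms : List (Finset α)) : Prop :=
  coatoms.Nodup ∧ ∀ x, x ∈ coatoms ↔ IsMaximalBelow 𝓛 G x ∧ ∀ y ∈ S, ¬ x ⊆ y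

theorem ListsCoatoms.perm {𝓛 : Set (Finset α)} {G : Finset α} {S l l' : List (Finset α)}
    (h : ListsCoatoms 𝓛 G S l) (hl : l'.Perm l) : ListsCoatoms 𝓛 G S l' :=
  ⟨hl.nodup_iff.2 h.1, fun x => hl.mem_iff.trans (h.2 x)⟩

variable [DecidableEq α]

theorem mem_inclusionMaximals {l : List (Finset α)} {x : Finset α} :
    x ∈ inclusionMaximals l ↔ x ∈ l ∧ ∀ y ∈ l, x ⊆ y → x = y := by
  simp [inclusionMaximals]

theorem nodup_inclusionMaximals (l : List (Finset α)) : (inclusionMaximals l).Nodup :=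
  (List.nodup_dedup l).filter _

/-- Enlarge a bypass of `c ⊂ a ⊂ G` to a coatom `b` of `G`. Then `a ∩ b` is a member strictly below
`a` containing `c`, so maximality of `c` forces equality. -/
theorem HasBypass.exists_inter_eq {𝓛 : Set (Finset α)} (h : HasBypass 𝓛)
    (hinter : ∀ x ∈ 𝓛, ∀ y ∈ 𝓛, x ∩ y ∈ 𝓛) {G a c : Finset α} (hG : G ∈ 𝓛)
    (ha : IsMaximalBelow 𝓛 G a) (hc : IsMaximalBelow 𝓛 a c) :
    ∃ b, IsMaximalBelow 𝓛 G b ∧ b ≠ a ∧ a ∩ b = c := by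
  obtain ⟨b₀, hb₀, hcb₀, hb₀G, hb₀a⟩ := h hc.1.1 ha.1.1 hG hc.1.2 ha.1.2
  obtain ⟨b, hb₀b, hb⟩ := exists_isMaximalBelow_ge hb₀ hb₀G
  have hne : b ≠ a := fun e => hb₀a (e ▸ hb₀b)
  have hlt : a ∩ b ⊂ a := by
    refine Finset.inter_subset_left.ssubset_of_ne fun e => hne ?_
    exact (ha.eq_of_subset hb.1.1 hb.1.2 (Finset.inter_eq_left.1 e)).symm
  exact ⟨b, hb, hne, (hc.eq_of_subset (hinter _ ha.1.1 _ hb.1.1) hlt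
    (Finset.subset_inter hc.1.2.subset (hcb₀.trans hb₀b))).symm⟩

theorem ListsCoatoms.newCoatoms {𝓛 : Set (Finset α)} (hby : HasBypass 𝓛)
    (hinter : ∀ x ∈ 𝓛, ∀ y ∈ 𝓛, x ∩ y ∈ 𝓛) {G a : Finset α} (hG : G ∈ 𝓛)
    {S coatoms : List (Finset α)} (h : ListsCoatoms 𝓛 G S coatoms) (ha : a ∈ coatoms) :
    ListsCoatoms 𝓛 a S (newCoatoms a coatoms S) := by
  have haG := ((h.2 a).1 ha).1
  set N := ((coatoms.filter (fun b => b ≠ a)).map (fun b => a ∩ b)).filter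
      (fun x => ∀ y ∈ S, ¬ x ⊆ y) with hN
  have below : ∀ x ∈ N, (x ∈ 𝓛 ∧ x ⊂ a) ∧ ∀ y ∈ S, ¬ x ⊆ y := by
    intro x hx
    simp only [hN, List.mem_filter, List.mem_map, decide_eq_true_eq] at hx
    obtain ⟨⟨b, ⟨hb, hne⟩, rfl⟩, hS⟩ := hx
    have hbG := ((h.2 b).1 hb).1
    refine ⟨⟨hinter _ haG.1.1 _ hbG.1.1, ?_⟩, hS⟩
    refine Finset.inter_subset_left.ssubset_of_ne fun e => hne ?_
    exact (haG.eq_of_subset hbG.1.1 hbG.1.2 (Finset.inter_eq_left.1 e)).symm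
  have mem : ∀ c, IsMaximalBelow 𝓛 a c → (∀ y ∈ S, ¬ c ⊆ y) → c ∈ N := by
    intro c hc hS
    obtain ⟨b, hb, hne, rfl⟩ := hby.exists_inter_eq hinter hG haG hc
    simp only [hN, List.mem_filter, List.mem_map, decide_eq_true_eq]
    -- An ignored set containing `b` would contain `a ∩ b`, so `b` is still listed.
    exact ⟨⟨b, ⟨(h.2 b).2 ⟨hb, fun y hy hby => hS y hy (Finset.inter_subset_right.trans hby)⟩,
      hne⟩, rfl⟩, hS⟩
  refine ⟨nodup_inclusionMaximals _, fun x => ?_⟩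
  change x ∈ inclusionMaximals N ↔ _
  rw [mem_inclusionMaximals]
  constructor
  · rintro ⟨hx, hmax⟩
    obtain ⟨⟨hx𝓛, hxa⟩, hS⟩ := below x hx
    obtain ⟨c, hxc, hc⟩ := exists_isMaximalBelow_ge hx𝓛 hxa
    have := hmax c (mem c hc fun y hy hcy => hS y hy (hxc.trans hcy)) hxc
    exact ⟨this ▸ hc, hS⟩
  · rintro ⟨hx, hS⟩
    exact ⟨mem x hx hS, fun y hy hxy => hx.eq_of_subset (below y hy).1.1 (below y hy).1.2 hxy⟩

theorem ListsCoatoms.nextCoatoms {𝓛 : Set (Finset α)} {G a : Finset α}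
    {S coatoms : List (Finset α)} (h : ListsCoatoms 𝓛 G S coatoms) :
    ListsCoatoms 𝓛 G (S ++ [a ∪ ∅]) (nextCoatoms a coatoms ∅) := by
  refine ⟨h.1.filter _, fun x => ?_⟩
  simp only [FaceIteration.nextCoatoms, List.mem_filter, h.2 x, decide_eq_true_eq, and_assoc,
    List.mem_append, List.mem_singleton, or_imp, forall_and, forall_eq]

theorem faceIterator_spec {𝓛 : Set (Finset α)} (hby : HasBypass 𝓛)
    (hinter : ∀ x ∈ 𝓛, ∀ y ∈ 𝓛, x ∩ y ∈ 𝓛)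
    (arrange : List (Finset α) → List (Finset α)) (harrange : ∀ l, (arrange l).Perm l) :
    ∀ (k : ℕ) (coatoms S : List (Finset α)) (G : Finset α), coatoms.length ≤ k → G ∈ 𝓛 →
      ListsCoatoms 𝓛 G S coatoms →
      (faceIterator arrange harrange coatoms S ∅).Nodup ∧
      ∀ x, x ∈ faceIterator arrange harrange coatoms S ∅ ↔
        x ∈ 𝓛 ∧ x ⊂ G ∧ ∀ y ∈ S, ¬ x ⊆ y := by
  intro k
  induction k with
  | zero =>
    intro coatoms S G hk hG h
    obtain rfl : coatoms = [] := List.length_eq_zero_iff.1 (Nat.le_zero.1 hk)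
    rw [faceIterator]
    -- A non-ignored member below `G` would lie under a maximal one, itself non-ignored and hence
    -- listed.
    refine ⟨List.nodup_nil, fun x => ⟨fun hx => absurd hx List.not_mem_nil, ?_⟩⟩
    rintro ⟨hx, hxG, hS⟩
    obtain ⟨y, hxy, hy⟩ := exists_isMaximalBelow_ge hx hxG
    refine absurd ((h.2 y).2 ?_) List.not_mem_nil
    exact ⟨hy, fun z hz hyz => hS z hz (hxy.trans hyz)⟩
  | succ k ih =>
    intro coatoms S G hk hG h
    rcases coatoms with _ | ⟨a, rest⟩
    · exact ih [] S G (Nat.zero_le _) hG h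
    have ha := (h.2 a).1 List.mem_cons_self
    have hnew := (h.newCoatoms hby hinter hG List.mem_cons_self).perm (harrange _)
    have hnext := (h.nextCoatoms (a := a)).perm (harrange _)
    have hl₁ := length_newCoatoms_lt a rest S
    have hl₂ := length_nextCoatoms_lt a rest ∅
    obtain ⟨nd₁, m₁⟩ := ih _ S a (by rw [(harrange _).length_eq]; omega) ha.1.1.1 hnew
    obtain ⟨nd₂, m₂⟩ := ih _ _ G (by rw [(harrange _).length_eq]; omega) hG hnext
    rw [faceIterator, if_pos (Finset.inter_empty a)]
    have hnot : ∀ x, x ∈ faceIterator arrange harrange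
        (arrange (FaceIteration.nextCoatoms a (a :: rest) ∅)) (S ++ [a ∪ ∅]) ∅ → ¬ x ⊆ a := by
      intro x hx
      simpa using ((m₂ x).1 hx).2.2 (a ∪ ∅) (by simp)
    constructor
    · rw [List.append_assoc, List.singleton_append, List.nodup_cons, List.nodup_append']
      refine ⟨?_, nd₁, nd₂, fun x hx hx' => hnot x hx' ((m₁ x).1 hx).2.1.subset⟩
      rw [List.mem_append]
      rintro (hx | hx)
      · exact ((m₁ a).1 hx).2.1.ne rfl
      · exact hnot a hx subset_rfl
    · intro x
      rw [List.append_assoc, List.singleton_append, List.mem_cons, List.mem_append, m₁, m₂]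
      constructor
      · rintro (rfl | ⟨hx, hxa, hS⟩ | ⟨hx, hxG, hS⟩)
        · exact ⟨ha.1.1.1, ha.1.1.2, ha.2⟩
        · exact ⟨hx, hxa.trans ha.1.1.2, hS⟩
        · exact ⟨hx, hxG, fun y hy => hS y (List.mem_append_left _ hy)⟩
      · rintro ⟨hx, hxG, hS⟩
        by_cases hxa : x ⊆ a
        · rcases hxa.eq_or_ssubset with e | hlt
          · exact Or.inl e
          · exact Or.inr (Or.inl ⟨hx, hlt, hS⟩)
        · refine Or.inr (Or.inr ⟨hx, hxG, fun y hy => ?_⟩)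
          rcases List.mem_append.1 hy with hy | hy
          · exact hS y hy
          · simpa [List.mem_singleton.1 hy] using hxa

end Combinatorics

/-! ### Zero sets of nonpositive functions in a linear space -/

section ZeroSets

variable {ι : Type*}

/-- Rotating `u` in the direction `h` until it vanishes at a new point. -/
theorem exists_rotation (s : Finset ι) (u h : ι → ℝ) (hu : ∀ i ∈ s, u i ≤ 0)
    (hh : ∃ i ∈ s, 0 < h i) :
    ∃ t : ℝ, (∀ i ∈ s, u i + t * h i ≤ 0) ∧ ∃ i ∈ s, 0 < h i ∧ u i + t * h i = 0 := by
  obtain ⟨i₀, hi₀, hpos⟩ := hh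
  -- The step length `t` is the least ratio `-u i / h i` over the indices where `h` is positive.
  obtain ⟨j, hj, hmin⟩ := (s.filter (fun i => 0 < h i)).exists_min_image (fun i => -u i / h i)
    ⟨i₀, by simp [hi₀, hpos]⟩
  rw [Finset.mem_filter] at hj
  have ht : 0 ≤ -u j / h j := div_nonneg (neg_nonneg.2 (hu j hj.1)) hj.2.le
  refine ⟨-u j / h j, fun i hi => ?_, j, hj.1, hj.2, ?_⟩
  · rcases lt_or_ge 0 (h i) with hp | hn
    · have := (le_div_iff₀ hp).1 (hmin i (by simp [hi, hp]))
      linarith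
    · have := mul_nonpos_of_nonneg_of_nonpos ht hn
      linarith [hu i hi]
  · have := hj.2.ne'
    field_simp
    ring

/-- The zero sets of the nonpositive functions in `U`. -/
def zeroSets (U : Submodule ℝ (ι → ℝ)) : Set (Finset ι) :=
  {A | ∃ u ∈ U, (∀ i, u i ≤ 0) ∧ ∀ i, i ∈ A ↔ u i = 0}

theorem inter_mem_zeroSets [DecidableEq ι] {U : Submodule ℝ (ι → ℝ)} {A B : Finset ι} (hA : A ∈ zeroSets U)
    (hB : B ∈ zeroSets U) : A ∩ B ∈ zeroSets U := by
  obtain ⟨u, hu, hu0, hA⟩ := hA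
  obtain ⟨w, hw, hw0, hB⟩ := hB
  refine ⟨u + w, U.add_mem hu hw, fun i => add_nonpos (hu0 i) (hw0 i), fun i => ?_⟩
  rw [Finset.mem_inter, hA, hB, Pi.add_apply]
  have := hu0 i
  have := hw0 i
  constructor
  · rintro ⟨h, h'⟩; linarith
  · intro h; constructor <;> linarith

variable [Fintype ι]

theorem univ_mem_zeroSets (U : Submodule ℝ (ι → ℝ)) : Finset.univ ∈ zeroSets U :=
  ⟨0, U.zero_mem, by simp, by simp⟩

theorem exists_dominating_multiple (u g : ι → ℝ) :
    ∃ K : ℝ, ∀ i, g i < 0 → u i + K * g i < 0 := by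
  obtain ⟨K, hK⟩ := (Set.finite_range fun i => u i / (-g i)).bddAbove
  refine ⟨max K 0 + 1, fun i hi => ?_⟩
  have h1 : u i / (-g i) ≤ max K 0 := (hK ⟨i, rfl⟩).trans (le_max_left _ _)
  rw [div_le_iff₀ (by linarith)] at h1
  linarith

/-- Rotate `γ` along `-α` within `G` until a zero appears outside `a`. On `a` nothing changes, so
`c` stays in the zero set and a point of `a` outside `c` stays out of it. A large multiple of `g`
restores negativity outside `G` without affecting `G`. -/
theorem hasBypass_zeroSets (U : Submodule ℝ (ι → ℝ)) : HasBypass (zeroSets U) := by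
  rintro c a G ⟨γ, hγ, hγ0, hc⟩ ⟨α, hα, hα0, ha⟩ ⟨g, hg, hg0, hG⟩ hca haG
  obtain ⟨i₀, hi₀G, hi₀a⟩ := Finset.exists_of_ssubset haG
  obtain ⟨j, hja, hjc⟩ := Finset.exists_of_ssubset hca
  obtain ⟨t, hle, i, hiG, hi, hi0⟩ := exists_rotation G γ (-α) (fun i _ => hγ0 i)
    ⟨i₀, hi₀G, by
      have := lt_of_le_of_ne (hα0 i₀) fun e => hi₀a ((ha i₀).2 e)
      simpa using this⟩
  obtain ⟨K, hdom⟩ := exists_dominating_multiple (γ + t • -α) g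
  set b : ι → ℝ := γ + t • -α + K • g with hb
  have hbG : ∀ i ∈ G, b i = γ i + t * (-α) i := by
    intro i hi
    simp [hb, (hG i).1 hi]
  have hbG' : ∀ i, i ∉ G → b i < 0 := fun i hi =>
    hdom i (lt_of_le_of_ne (hg0 i) fun e => hi ((hG i).2 e))
  have hsub : Finset.univ.filter (fun i => b i = 0) ⊆ G := by
    intro i hi
    by_contra hiG
    exact (hbG' i hiG).ne (Finset.mem_filter.1 hi).2
  refine ⟨Finset.univ.filter (fun i => b i = 0), ⟨b, ?_, fun i => ?_, by simp⟩, ?_, ?_, ?_⟩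
  · exact U.add_mem (U.add_mem hγ (U.smul_mem _ (U.neg_mem hα))) (U.smul_mem _ hg)
  · by_cases hiG : i ∈ G
    · rw [hbG i hiG]; exact hle i hiG
    · exact (hbG' i hiG).le
  · intro k hk
    have hka := hca.subset hk
    rw [Finset.mem_filter, hbG k (haG.subset hka)]
    simp [(hc k).1 hk, (ha k).1 hka]
  · refine hsub.ssubset_of_ne fun e => ?_
    have hjG := haG.subset hja
    have h1 := hbG j hjG
    rw [← e, Finset.mem_filter] at hjG
    rw [hjG.2] at h1
    refine hjc ((hc j).2 ?_)
    simpa [(ha j).1 hja] using h1.symm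
  · intro hba
    have : i ∈ a := hba (by rw [Finset.mem_filter, hbG i hiG]; exact ⟨Finset.mem_univ _, hi0⟩)
    simp [(ha i).1 this] at hi

end ZeroSets

end FaceIteration
namespace FaceIteration

/-! ### Faces, vertices and facets of a polytope -/

section Geometry

theorem mem_vertexSet {E : Type*} {n : ℕ} {v : Fin n → E} {F : Set E} {i : Fin n} : i ∈ vertexSet v F ↔ v i ∈ F := by
  simp [vertexSet]

variable {E : Type*} [NormedAddCommGroup E] [NormedSpace ℝ E]

/-- By Krein–Milman, since extreme points of a face are extreme in the polytope and so lie in `S`.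
-/
theorem isFace_eq_convexHull_inter {S F : Set E} (hS : S.Finite)
    (hF : IsFace (convexHull ℝ S) F) : F = convexHull ℝ (S ∩ F) := by
  have hconv : Convex ℝ F := IsExposed.convex hF (convex_convexHull ℝ S)
  have hcomp : IsCompact F := IsExposed.isCompact hF (hS.isCompact_convexHull ℝ)
  have hext : F.extremePoints ℝ ⊆ S ∩ F := fun x hx =>
    ⟨extremePoints_convexHull_subset
      ((IsExposed.isExtreme hF).extremePoints_subset_extremePoints hx), hx.1⟩
  refine Set.Subset.antisymm ?_ (convexHull_min Set.inter_subset_right hconv)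
  conv_lhs => rw [← closure_convexHull_extremePoints hcomp hconv]
  exact closure_minimal (convexHull_mono hext) ((hS.inter_of_left F).isClosed_convexHull ℝ)

theorem extremePoints_subset_vertices {S : Set E} (hS : S.Finite) :
    (convexHull ℝ S).extremePoints ℝ ⊆ vertices (convexHull ℝ S) := by
  intro x hx
  have hxS : x ∉ convexHull ℝ (S \ {x}) := fun h =>
    ((convex_convexHull ℝ S).mem_extremePoints_iff_mem_sdiff_convexHull_sdiff.1 hx).2
      (convexHull_mono (Set.sdiff_subset_sdiff_left (subset_convexHull ℝ S)) h)
  -- A functional separating `x` from the hull of the other generators exposes exactly `{x}`.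
  obtain ⟨l, r, hlt, hr⟩ := geometric_hahn_banach_closed_point (convex_convexHull ℝ (S \ {x}))
    (hS.sdiff.isClosed_convexHull ℝ) hxS
  have hlt' : ∀ y ∈ S, y ≠ x → l y < l x := fun y hy hne =>
    (hlt y (subset_convexHull ℝ _ ⟨hy, hne⟩)).trans hr
  have hle : convexHull ℝ S ⊆ {y | l y ≤ l x} := by
    refine convexHull_min (fun y hy => ?_) (convex_halfSpace_le l.toLinearMap.isLinear _)
    rcases eq_or_ne y x with rfl | hne
    · exact le_refl (l y)
    · exact (hlt' y hy hne).le
  have hF : IsFace (convexHull ℝ S) (l.toExposed (convexHull ℝ S)) :=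
    ContinuousLinearMap.toExposed.isExposed
  have hxF : x ∈ l.toExposed (convexHull ℝ S) := ⟨hx.1, fun y hy => hle hy⟩
  have heq : l.toExposed (convexHull ℝ S) = {x} := by
    refine Set.Subset.antisymm ?_ (Set.singleton_subset_iff.2 hxF)
    rw [isFace_eq_convexHull_inter hS hF]
    refine convexHull_min (fun y hy => ?_) (convex_singleton x)
    by_contra hne
    exact (hlt' y hy.1 hne).not_ge (hy.2.2 x hx.1)
  change IsFace _ _
  rw [← heq]
  exact hF

theorem IsPolytope.eq_convexHull_vertices {P : Set E} (hP : IsPolytope P) :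
    P = convexHull ℝ (vertices P) := by
  obtain ⟨S, hS, rfl⟩ := hP
  have hsub : (convexHull ℝ S).extremePoints ℝ ⊆ S := extremePoints_convexHull_subset
  have hvert : vertices (convexHull ℝ S) ⊆ convexHull ℝ S := fun x hx =>
    IsExposed.subset hx (Set.mem_singleton x)
  refine Set.Subset.antisymm ?_ (convexHull_min hvert (convex_convexHull ℝ S))
  conv_lhs => rw [← closure_convexHull_extremePoints (hS.isCompact_convexHull ℝ)
    (convex_convexHull ℝ S)]
  rw [((hS.subset hsub).isClosed_convexHull ℝ).closure_eq]
  exact convexHull_mono (extremePoints_subset_vertices hS)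

/-- The restrictions of the affine functions to the points of the family `v`. -/
def affineValues {ι : Type*} (v : ι → E) : Submodule ℝ (ι → ℝ) where
  carrier := {w | ∃ (l : E →L[ℝ] ℝ) (c : ℝ), ∀ i, w i = l (v i) + c}
  zero_mem' := ⟨0, 0, by simp⟩
  add_mem' := by
    rintro a b ⟨l, c, h⟩ ⟨l', c', h'⟩
    exact ⟨l + l', c + c', fun i => by simp [h, h']; ring⟩
  smul_mem' := by
    rintro r a ⟨l, c, h⟩
    exact ⟨r • l, r * c, fun i => by simp [h]; ring⟩

variable {n : ℕ} {v : Fin n → E}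

theorem vertexSet_convexHull : vertexSet v (convexHull ℝ (Set.range v)) = Finset.univ := by
  ext i
  simpa [mem_vertexSet] using subset_convexHull ℝ _ (Set.mem_range_self i)

theorem subset_of_vertexSet_subset {F F' : Set E} (hF : IsFace (convexHull ℝ (Set.range v)) F)
    (hF' : IsFace (convexHull ℝ (Set.range v)) F') (h : vertexSet v F ⊆ vertexSet v F') :
    F ⊆ F' := by
  rw [isFace_eq_convexHull_inter (Set.finite_range v) hF,
    isFace_eq_convexHull_inter (Set.finite_range v) hF']
  refine convexHull_mono ?_
  rintro _ ⟨⟨i, rfl⟩, hi⟩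
  exact ⟨⟨i, rfl⟩, mem_vertexSet.1 (h (mem_vertexSet.2 hi))⟩

theorem injOn_vertexSet :
    Set.InjOn (vertexSet v) {F | IsFace (convexHull ℝ (Set.range v)) F} := fun _ hF _ hF' h =>
  Set.Subset.antisymm (subset_of_vertexSet_subset hF hF' h.subset)
    (subset_of_vertexSet_subset hF' hF h.superset)

theorem image_vertexSet_faces :
    vertexSet v '' {F | IsFace (convexHull ℝ (Set.range v)) F} = zeroSets (affineValues v) := by
  have hmem : ∀ i, v i ∈ convexHull ℝ (Set.range v) := fun i =>
    subset_convexHull ℝ _ (Set.mem_range_self i)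
  ext A
  constructor
  · rintro ⟨F, hF, rfl⟩
    rcases F.eq_empty_or_nonempty with rfl | hne
    -- The empty face is the zero set of the constant `-1`.
    · exact ⟨fun _ => -1, ⟨0, -1, by simp⟩, by simp, by simp [mem_vertexSet]⟩
    · obtain ⟨l, hl⟩ := hF hne
      obtain ⟨x, hx⟩ := hne
      have hx' : ∀ y ∈ convexHull ℝ (Set.range v), l y ≤ l x := (hl.subset hx).2
      refine ⟨fun i => l (v i) + -l x, ⟨l, -l x, fun _ => rfl⟩, fun i => ?_, fun i => ?_⟩
      · linarith [hx' _ (hmem i)]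
      · rw [mem_vertexSet, add_neg_eq_zero]
        constructor
        · intro hi
          exact (hx' _ (hmem i)).antisymm ((hl.subset hi).2 x (hl.subset hx).1)
        · intro hi
          exact hl.superset ⟨hmem i, fun y hy => hi ▸ hx' y hy⟩
  · rintro ⟨u, ⟨l, c, hu⟩, hu0, hA⟩
    have hle : convexHull ℝ (Set.range v) ⊆ {y | l y ≤ -c} := by
      refine convexHull_min ?_ (convex_halfSpace_le l.toLinearMap.isLinear _)
      rintro _ ⟨i, rfl⟩
      have := hu i ▸ hu0 i
      change l (v i) ≤ -c
      linarith
    refine ⟨{x | x ∈ convexHull ℝ (Set.range v) ∧ l x = -c}, ?_, ?_⟩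
    · rintro ⟨x, hx, hxc⟩
      refine ⟨l, Set.ext fun y => and_congr_right fun hy => ⟨fun h z hz => ?_, fun h => ?_⟩⟩
      · rw [h]; exact hle hz
      · exact (hle hy).antisymm (hxc ▸ h x hx)
    · ext i
      rw [mem_vertexSet, hA, hu]
      simp [hmem i, eq_neg_iff_add_eq_zero]

theorem vectorSpan_le_ker {s : Set E} {l : E →ₗ[ℝ] ℝ} {c : ℝ} (h : ∀ x ∈ s, l x = c) :
    vectorSpan ℝ s ≤ LinearMap.ker l := by
  rw [vectorSpan_def, Submodule.span_le]
  rintro _ ⟨x, hx, y, hy, rfl⟩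
  simp [h x hx, h y hy]

theorem dim_of_nonempty {F : Set E} (h : F.Nonempty) :
    dim F = Module.finrank ℝ (vectorSpan ℝ F) := if_pos h

theorem dim_empty : dim (∅ : Set E) = -1 := if_neg Set.not_nonempty_empty

variable [FiniteDimensional ℝ E]

/-- The functional exposing `F` is constant on `F`. If both direction spaces agreed, it would be
constant on `F'`, forcing `F' ⊆ F`. -/
theorem dim_lt_dim {P F F' : Set E} (hF : IsFace P F) (hF' : IsFace P F') (h : F ⊂ F') :
    dim F < dim F' := by
  obtain ⟨x, hx, hxF⟩ := Set.exists_of_ssubset h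
  rw [dim_of_nonempty ⟨x, hx⟩]
  rcases F.eq_empty_or_nonempty with rfl | hne
  · rw [dim_empty]; omega
  rw [dim_of_nonempty hne, Nat.cast_lt]
  obtain ⟨l, hl⟩ := hF hne
  obtain ⟨x₀, hx₀⟩ := hne
  refine Submodule.finrank_lt_finrank_of_lt ((vectorSpan_mono ℝ h.subset).lt_of_not_ge fun hle => ?_)
  have hker : vectorSpan ℝ F ≤ LinearMap.ker l.toLinearMap :=
    vectorSpan_le_ker (c := l x₀) fun y hy =>
      ((hl.subset hx₀).2 y (hl.subset hy).1).antisymm ((hl.subset hy).2 x₀ (hl.subset hx₀).1)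
  have h0 := hker (hle (vsub_mem_vectorSpan ℝ hx (h.subset hx₀)))
  have hxx : l x = l x₀ := by simpa [sub_eq_zero] using h0
  exact hxF (hl.superset ⟨IsExposed.subset hF' hx, fun y hy => hxx ▸ (hl.subset hx₀).2 y hy⟩)

/-- An affine function vanishing on `F` and at `p`, but not at all points of `v`. -/
theorem exists_affineValues_of_dim_lt {F : Set E} (p : Fin n)
    (hdim : dim F < dim (convexHull ℝ (Set.range v)) - 1) :
    ∃ h ∈ affineValues v, h p = 0 ∧ (∀ i ∈ vertexSet v F, h i = 0) ∧ ∃ q, h q ≠ 0 := by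
  set P := convexHull ℝ (Set.range v) with hP
  have hpP : v p ∈ P := subset_convexHull ℝ _ (Set.mem_range_self p)
  -- One extra point raises the dimension by at most one, so `F` and `p` together still do not span
  -- the directions of `P`.
  have hfin : Module.finrank ℝ (vectorSpan ℝ (insert (v p) F)) <
      Module.finrank ℝ (vectorSpan ℝ P) := by
    rw [dim_of_nonempty ⟨_, hpP⟩] at hdim
    rcases F.eq_empty_or_nonempty with rfl | hne
    · rw [dim_empty] at hdim
      rw [insert_empty_eq, vectorSpan_singleton, finrank_bot]
      omega
    · rw [dim_of_nonempty hne] at hdim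
      have := finrank_vectorSpan_insert_le_set ℝ F (v p)
      omega
  obtain ⟨w, hwP, hw⟩ : ∃ w ∈ vectorSpan ℝ P, w ∉ vectorSpan ℝ (insert (v p) F) :=
    Set.not_subset.1 fun hle => hfin.not_ge (Submodule.finrank_mono hle)
  obtain ⟨m, hmw, hm⟩ := Submodule.exists_le_ker_of_notMem hw
  refine ⟨fun i => m (v i) + -m (v p), ⟨m.toContinuousLinearMap, -m (v p), fun _ => rfl⟩,
    add_neg_cancel _, fun i hi => ?_, ?_⟩
  · have := hm (vsub_mem_vectorSpan ℝ (Set.mem_insert_of_mem (v p) (mem_vertexSet.1 hi))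
      (Set.mem_insert (v p) F))
    simpa [sub_eq_add_neg] using this
  · by_contra! hq
    have hconst : P ⊆ {y | m y = m (v p)} := by
      refine convexHull_min ?_ (convex_hyperplane m.isLinear _)
      rintro _ ⟨i, rfl⟩
      exact add_neg_eq_zero.1 (hq i)
    exact hmw (vectorSpan_le_ker hconst hwP)

/-- If the dimension were smaller, some `h` would vanish on `F` and at a vertex `p` off `F`, but not
everywhere. Rotating the function defining `F` along `h` gains a zero and keeps `p` out,
contradicting maximality. -/
theorem dim_eq_of_isMaximalBelow {F : Set E} (hF : IsFace (convexHull ℝ (Set.range v)) F)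
    (hmax : IsMaximalBelow (zeroSets (affineValues v)) Finset.univ (vertexSet v F)) :
    dim F = dim (convexHull ℝ (Set.range v)) - 1 := by
  have hlt : dim F < dim (convexHull ℝ (Set.range v)) := by
    refine dim_lt_dim hF (IsExposed.refl _)
      ((IsExposed.subset hF).ssubset_of_ne fun e => hmax.1.2.ne ?_)
    rw [e, vertexSet_convexHull]
  by_contra hne
  obtain ⟨p, -, hp⟩ := Finset.exists_of_ssubset hmax.1.2
  obtain ⟨h₀, hh₀, hp₀, hF₀, q, hq₀⟩ := exists_affineValues_of_dim_lt (v := v) (F := F) p (by omega)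
  obtain ⟨h, hh, hph, hFh, hq⟩ : ∃ h ∈ affineValues v, h p = 0 ∧
      (∀ i ∈ vertexSet v F, h i = 0) ∧ 0 < h q := by
    rcases hq₀.lt_or_gt with hneg | hpos
    · exact ⟨-h₀, Submodule.neg_mem _ hh₀, by simp [hp₀], fun i hi => by simp [hF₀ i hi],
        by simpa using hneg⟩
    · exact ⟨h₀, hh₀, hp₀, hF₀, hpos⟩
  obtain ⟨u, hu, hu0, hA⟩ := hmax.1.1
  obtain ⟨t, hle, i, -, hi, hi0⟩ := exists_rotation Finset.univ u h (fun i _ => hu0 i)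
    ⟨q, Finset.mem_univ q, hq⟩
  set B := Finset.univ.filter (fun i => u i + t * h i = 0) with hB
  have hB𝓛 : B ∈ zeroSets (affineValues v) :=
    ⟨u + t • h, Submodule.add_mem _ hu (Submodule.smul_mem _ _ hh),
      fun i => hle i (Finset.mem_univ i), by simp [hB]⟩
  have hpB : p ∉ B := by
    simpa [hB, hph] using fun e => hp ((hA p).2 e)
  have hFB : vertexSet v F ⊆ B := fun j hj => by
    simp [hB, hFh j hj, (hA j).1 hj]
  have heq := hmax.eq_of_subset hB𝓛
    ((Finset.subset_univ B).ssubset_of_ne fun e => hpB (e ▸ Finset.mem_univ p)) hFB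
  have hiF : i ∈ vertexSet v F := by
    rw [heq, hB, Finset.mem_filter]
    exact ⟨Finset.mem_univ i, hi0⟩
  exact hi.ne' (hFh i hiF)

/-- Dimension is strictly monotone on faces, and no integer lies strictly between `dim P - 1` and
`dim P`. -/
theorem isMaximalBelow_of_dim_eq {F : Set E} (hF : IsFace (convexHull ℝ (Set.range v)) F)
    (hdim : dim F = dim (convexHull ℝ (Set.range v)) - 1) :
    IsMaximalBelow (zeroSets (affineValues v)) Finset.univ (vertexSet v F) := by
  have hP : IsFace (convexHull ℝ (Set.range v)) (convexHull ℝ (Set.range v)) := IsExposed.refl _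
  have hne : F ≠ convexHull ℝ (Set.range v) := fun e => by rw [← e] at hdim; omega
  refine ⟨⟨image_vertexSet_faces.subset ⟨F, hF, rfl⟩, (Finset.subset_univ _).ssubset_of_ne
    fun e => hne (injOn_vertexSet hF hP (e.trans vertexSet_convexHull.symm))⟩, ?_⟩
  rintro y ⟨hy, hyu⟩ hFy
  obtain ⟨F', hF', rfl⟩ := image_vertexSet_faces.superset hy
  have hne' : F' ≠ convexHull ℝ (Set.range v) := fun e => hyu.ne (by rw [e, vertexSet_convexHull])
  have hlt := dim_lt_dim hF' hP ((IsExposed.subset hF').ssubset_of_ne hne')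
  have hsub := subset_of_vertexSet_subset hF hF' hFy
  rcases eq_or_ne F F' with rfl | hFF
  · exact le_rfl
  · have := dim_lt_dim hF hF' (hsub.ssubset_of_ne hFF)
    omega

theorem listsCoatoms_coatomsOfIncidences {m : ℕ} {f : Fin m → Set E}
    (hf : Function.Injective f) (hf_range : Set.range f = facets (convexHull ℝ (Set.range v)))
    {I : Matrix (Fin n) (Fin m) Bool} (hI : ∀ i j, I i j = true ↔ v i ∈ f j) :
    ListsCoatoms (zeroSets (affineValues v)) Finset.univ [] (coatomsOfIncidences I) := by
  have hfacet : ∀ j, f j ∈ facets (convexHull ℝ (Set.range v)) := fun j =>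
    hf_range.subset (Set.mem_range_self j)
  have hlist : coatomsOfIncidences I = List.ofFn fun j => vertexSet v (f j) := by
    unfold coatomsOfIncidences
    congr 1
    funext j
    ext i
    simp [mem_vertexSet, hI]
  rw [hlist]
  constructor
  · exact List.nodup_ofFn.2 fun j k hjk => hf (injOn_vertexSet (hfacet j).1 (hfacet k).1 hjk)
  · intro x
    simp only [List.mem_ofFn, List.not_mem_nil, false_imp_iff, implies_true, and_true]
    constructor
    · rintro ⟨j, rfl⟩
      exact isMaximalBelow_of_dim_eq (hfacet j).1 (hfacet j).2
    · intro hx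
      obtain ⟨F, hF, rfl⟩ := image_vertexSet_faces.superset hx.1.1
      obtain ⟨j, rfl⟩ := hf_range.superset ⟨hF, dim_eq_of_isMaximalBelow hF hx⟩
      exact ⟨j, rfl⟩

end Geometry

end FaceIteration

theorem corollary3p4 {d : ℕ} (P : Set (EuclideanSpace ℝ (Fin d)))
    (hP : FaceIteration.IsPolytope P)
    {n m : ℕ}
    (v : Fin n → EuclideanSpace ℝ (Fin d)) (hv : Function.Injective v)
    (hv_range : Set.range v = FaceIteration.vertices P)
    (f : Fin m → Set (EuclideanSpace ℝ (Fin d))) (hf : Function.Injective f)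
    (hf_range : Set.range f = FaceIteration.facets P)
    (I : Matrix (Fin n) (Fin m) Bool) (hI : ∀ i j, I i j = true ↔ v i ∈ f j)
    (arrange : List (Finset (Fin n)) → List (Finset (Fin n)))
    (harrange : ∀ l, (arrange l).Perm l) :
    FaceIteration.VisitsExactlyOnce v
      (FaceIteration.faceIterator arrange harrange (FaceIteration.coatomsOfIncidences I) [] ∅)
      {F | FaceIteration.IsFace P F ∧ F ≠ P} ∧
    FaceIteration.VisitsExactlyOnce v
      (Finset.univ ::
        FaceIteration.faceIterator arrange harrange (FaceIteration.coatomsOfIncidences I) [] ∅)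
      {F | FaceIteration.IsFace P F} := by

  obtain rfl : P = convexHull ℝ (Set.range v) := hv_range ▸ hP.eq_convexHull_vertices
  have himage := FaceIteration.image_vertexSet_faces (v := v)
  have hinj := FaceIteration.injOn_vertexSet (v := v)
  have hself : FaceIteration.IsFace (convexHull ℝ (Set.range v)) (convexHull ℝ (Set.range v)) :=
    IsExposed.refl _
  have huniv := FaceIteration.vertexSet_convexHull (v := v)
  obtain ⟨hnodup, hmem⟩ := FaceIteration.faceIterator_spec
    (FaceIteration.hasBypass_zeroSets (FaceIteration.affineValues v))
    (fun _ hx _ hy => FaceIteration.inter_mem_zeroSets hx hy) arrange harrange _ _ [] Finset.univ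
    le_rfl (FaceIteration.univ_mem_zeroSets _)
    (FaceIteration.listsCoatoms_coatomsOfIncidences hf hf_range hI)
  simp only [List.not_mem_nil, false_imp_iff, implies_true, and_true] at hmem
  refine ⟨⟨hnodup, ?_, hinj.mono fun F hF => hF.1, ?_⟩, ⟨?_, ?_, hinj, ?_⟩⟩
  · rintro F ⟨hF, hne⟩
    refine (hmem _).2 ⟨himage.subset ⟨F, hF, rfl⟩, (Finset.subset_univ _).ssubset_of_ne fun e => ?_⟩
    exact hne (hinj hF hself (e.trans huniv.symm))
  · intro s hs
    obtain ⟨hs, hlt⟩ := (hmem s).1 hs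
    obtain ⟨F, hF, rfl⟩ := himage.superset hs
    exact ⟨F, ⟨hF, fun e => hlt.ne (by rw [e, huniv])⟩, rfl⟩
  -- The iterator outputs only proper subsets of `Finset.univ`, so prepending it creates no
  -- repetition.
  · exact List.nodup_cons.2 ⟨fun h => ((hmem _).1 h).2.ne rfl, hnodup⟩
  · intro F hF
    rw [Set.mem_ofPred_eq, List.mem_cons, hmem]
    rcases eq_or_ne (FaceIteration.vertexSet v F) Finset.univ with e | hne
    · exact Or.inl e
    · exact Or.inr ⟨himage.subset ⟨F, hF, rfl⟩, (Finset.subset_univ _).ssubset_of_ne hne⟩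
  · intro s hs
    rcases List.mem_cons.1 hs with rfl | hs
    · exact ⟨_, hself, huniv⟩
    · exact himage.superset ((hmem s).1 hs).1
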